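/- For a diffeological space $X$, let $T_2(X)=\operatorname{colim}_{P}\,(U_P\times\mathbb R^{\dim U_P}\times\mathbb R^{\dim U_P})$, the colimit being taken over the category of plots $P\colon U_P\to X$ ($U_P$ open in a Euclidean space), a morphism $P\to Q$ being a smooth map $h\colon U_P\to U_Q$ with $Q\circ h=P$, which acts by $(x,v,w)\mapsto(h(x),Dh_x v,Dh_x w)$; write $[x,v,w]_P$ for the class of $(x,v,w)$. A weak Riemannian metric on $X$ is a map $g\colon T_2(X)\to\mathbb R$ such that for every plot $P$ the function $g(P)_x(v,w)=g([x,v,w]_P)$ is a smooth symmetric positive semidefinite covariant $2$-tensor on $U_P$. It defines the pseudodistance $d_g\colon X\times X\to[0,\infty]$, $$d_g(x,y)=\inf_\gamma\int_0^1\bigl(g(\gamma)_t(1,1)\bigr)^{1/2}\,dt,$$ where $\gamma$ runs over the smooth maps $\gamma\colon\mathbb R\to X$ with $\gamma(0)=x$, $\gamma(1)=y$ (and $d_g(x,y)=\infty$ if there are none). Such a function is called a distance if it vanishes on the diagonal, is symmetric, satisfies the triangle inequality, and $d_g(x,y)=0$ implies $x=y$; the value $\infty$ is allowed. **Proposition 5.2.**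 Let $M$ be a closed orientable smooth manifold of finite dimension with a fixed volume form $\mathrm{vol}_M$ (a smooth nowhere vanishing form of top degree, $M$ being oriented so that it is positive), and let $N$ be a diffeological space with a weak Riemannian metric $g_N$. Give $M$ its standard diffeology and the set $C^\infty(M,N)$ of smooth maps the functional diffeology, and for a plot $P$ of $C^\infty(M,N)$, $r\in U_P$ and $v,w\in T_rU_P$ put $$g(P)_r(v,w)=\int_M g_N(\mathrm{ev}_m\circ P)_r(v,w)\,\mathrm{vol}_M ,$$ where $\mathrm{ev}_m(f)=f(m)$. Then the integrand is integrable and $g$ is a weak Riemannian metric on $C^\infty(M,N)$; and if the pseudodistance $d_{g_N}$ is a distance on $N$, then the pseudodistance $d_g$ is a distance on $C^\infty(M,N)$. -/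

import Mathlib

open Set MeasureTheory Diffeology
open scoped Manifold ContDiff ENNReal Topology

noncomputable section

namespace RiemDiff

universe u v

/-- The Euclidean space of dimension `n`. -/
abbrev Euc (n : ℕ) : Type := EuclideanSpace ℝ (Fin n)

/-! ## Products and mapping spaces of diffeological spaces

A diffeology is Mathlib's `DiffeologicalSpace`; smooth maps are Mathlib's `DSmooth`. -/

/-- The product diffeology: a map is a plot iff both of its components are plots. -/
instance prodDiffeology (X : Type u) (Y : Type v) [DiffeologicalSpace X] [DiffeologicalSpace Y] :
    DiffeologicalSpace (X × Y) where
  plots n := {p : Euc n → X × Y | IsPlot (fun r => (p r).1) ∧ IsPlot (fun r => (p r).2)}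
  constant_plots _ := ⟨isPlot_const, isPlot_const⟩
  plot_reparam hp hf := ⟨isPlot_reparam hp.1 hf, isPlot_reparam hp.2 hf⟩
  locality {n p} hp := by
    constructor
    · refine DiffeologicalSpace.locality fun x => ?_
      obtain ⟨u, hu, hxu, h⟩ := hp x
      exact ⟨u, hu, hxu, fun hf hfs => (h hf hfs).1⟩
    · refine DiffeologicalSpace.locality fun x => ?_
      obtain ⟨u, hu, hxu, h⟩ := hp x
      exact ⟨u, hu, hxu, fun hf hfs => (h hf hfs).2⟩

/-- The set `C^∞(X, Y)` of smooth maps between diffeological spaces. -/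
def SmoothMap (X : Type u) (Y : Type v) [DiffeologicalSpace X] [DiffeologicalSpace Y] :
    Type (max u v) :=
  {f : X → Y // DSmooth f}

instance (X : Type u) (Y : Type v) [DiffeologicalSpace X] [DiffeologicalSpace Y] :
    CoeFun (SmoothMap X Y) (fun _ => X → Y) :=
  ⟨Subtype.val⟩

/-- The functional diffeology on `C^∞(X, Y)`: a map `P` into `C^∞(X, Y)` is a plot iff its adjoint
`(r, x) ↦ P r x` is smooth on the product. -/
instance functionalDiffeology (X : Type u) (Y : Type v) [DiffeologicalSpace X]
    [DiffeologicalSpace Y] : DiffeologicalSpace (SmoothMap X Y) where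
  plots n := {P : Euc n → SmoothMap X Y | DSmooth (fun q : Euc n × X => P q.1 q.2)}
  constant_plots f := fun _ _ hp => f.2 _ _ hp.2
  plot_reparam {n m P f} hP hf := fun k p hp =>
    hP k (fun t => (f (p t).1, (p t).2)) ⟨(hf.comp hp.1.contDiff).isPlot, hp.2⟩
  locality {n P} hP := by
    intro k p hp
    refine DiffeologicalSpace.locality fun t => ?_
    obtain ⟨u, hu, htu, h⟩ := hP (p t).1
    refine ⟨(fun s => (p s).1) ⁻¹' u, hu.preimage hp.1.contDiff.continuous, htu, ?_⟩
    intro m f hf hfs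
    have h1 := h (f := fun s => (p (f s)).1) hf (hp.1.contDiff.comp hfs)
    exact h1 m (fun s => (s, (p (f s)).2)) ⟨isPlot_id', isPlot_reparam hp.2 hfs⟩

/-- Evaluation at a point, `ev_x : C^∞(X, Y) → Y`. -/
def ev {X : Type u} {Y : Type v} [DiffeologicalSpace X] [DiffeologicalSpace Y] (x : X) :
    SmoothMap X Y → Y :=
  fun f => f x

theorem dSmooth_ev {X : Type u} {Y : Type v} [DiffeologicalSpace X] [DiffeologicalSpace Y]
    (x : X) : DSmooth (ev x : SmoothMap X Y → Y) :=
  fun n _ hp => hp n (fun r => (r, x)) ⟨isPlot_id', isPlot_const⟩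

/-! ## Plots on domains and the space `T₂(X)` -/

/-- A plot of `X` whose domain is an open subset `dom` of a Euclidean space: a parametrization of
`X` on `dom` all of whose composites with smooth maps from Euclidean spaces into `dom` are plots.
The underlying function is a total function, whose values off `dom` play no role. -/
structure Plot (X : Type u) [DiffeologicalSpace X] where
  dim : ℕ
  dom : Set (Euc dim)
  isOpen_dom : IsOpen dom
  toFun : Euc dim → X
  isPlot_comp : ∀ (m : ℕ) (f : Euc m → Euc dim), ContDiff ℝ ∞ f → (∀ t, f t ∈ dom) →
    IsPlot (fun t => toFun (f t))

/-- The composite of a plot with a smooth map. -/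
def Plot.map {X : Type u} {Y : Type v} [DiffeologicalSpace X] [DiffeologicalSpace Y] {f : X → Y}
    (hf : DSmooth f) (P : Plot X) : Plot Y where
  dim := P.dim
  dom := P.dom
  isOpen_dom := P.isOpen_dom
  toFun := fun r => f (P.toFun r)
  isPlot_comp m h hh hm := hf _ _ (P.isPlot_comp m h hh hm)

/-- The disjoint union, over all plots `P` of `X`, of `U_P × ℝ^{dim U_P} × ℝ^{dim U_P}`. -/
def PreT₂ (X : Type u) [DiffeologicalSpace X] : Type u :=
  Σ P : Plot X, P.dom × Euc P.dim × Euc P.dim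

/-- The identifications made in the colimit over the category of plots: a morphism `P ⟶ Q` is a
smooth map `h : U_P → U_Q` with `Q ∘ h = P`, and it identifies `(x, v, w)` over `P` with
`(h x, (Dh)_x v, (Dh)_x w)` over `Q`. -/
inductive T₂Rel (X : Type u) [DiffeologicalSpace X] : PreT₂ X → PreT₂ X → Prop
  | mk (P Q : Plot X) (h : Euc P.dim → Euc Q.dim) (hsmooth : ContDiffOn ℝ ∞ h P.dom)
      (hmaps : ∀ r ∈ P.dom, h r ∈ Q.dom) (hcomp : ∀ r ∈ P.dom, Q.toFun (h r) = P.toFun r)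
      (x : P.dom) (v w : Euc P.dim) :
      T₂Rel X ⟨P, x, v, w⟩
        ⟨Q, ⟨h x, hmaps x x.2⟩, fderiv ℝ h x v, fderiv ℝ h x w⟩

/-- `T₂(X) = colim_P (U_P × ℝ^{dim U_P} × ℝ^{dim U_P})`, the colimit being taken over the category
of plots of `X`. -/
def T₂ (X : Type u) [DiffeologicalSpace X] : Type u :=
  Quot (T₂Rel X)

/-- The class `[x, v, w]_P` in `T₂(X)`. -/
def T₂.mk {X : Type u} [DiffeologicalSpace X] (P : Plot X) (x : P.dom) (v w : Euc P.dim) : T₂ X :=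
  Quot.mk _ ⟨P, x, v, w⟩

/-- The map `T₂(f) : T₂(X) → T₂(Y)`, `[x, v, w]_P ↦ [x, v, w]_{f ∘ P}`, induced by a smooth map
`f : X → Y`. -/
def T₂.map {X : Type u} {Y : Type v} [DiffeologicalSpace X] [DiffeologicalSpace Y] {f : X → Y}
    (hf : DSmooth f) : T₂ X → T₂ Y :=
  Quot.lift (fun ξ => T₂.mk (ξ.1.map hf) ξ.2.1 ξ.2.2.1 ξ.2.2.2) (by
    rintro _ _ ⟨P, Q, h, hs, hm, hc, x, v, w⟩
    exact Quot.sound (T₂Rel.mk (P.map hf) (Q.map hf) h hs hm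
      (fun r hr => congrArg f (hc r hr)) x v w))

/-! ## Weak Riemannian metrics and their pseudodistance -/

/-- A function `τ_x(v, w)` of `x ∈ U` and of two vectors is a (smooth) covariant 2-tensor on the
open set `U`: it is given by a smooth function on `U` with values in the bilinear forms. -/
def IsCovariantTwoTensor {d : ℕ} (U : Set (Euc d)) (τ : U → Euc d → Euc d → ℝ) : Prop :=
  ∃ B : Euc d → Euc d →L[ℝ] Euc d →L[ℝ] ℝ,
    ContDiffOn ℝ ∞ B U ∧ ∀ (x : U) (v w : Euc d), τ x v w = B x v w

/-- `g : T₂(X) → ℝ` is a weak Riemannian metric: for each plot `P`, the function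
`g(P)_x(v, w) = g [x, v, w]_P` is a symmetric and positive (that is, positive semidefinite)
covariant 2-tensor on the domain of `P`. -/
structure IsWeakRiemannianMetric {X : Type u} [DiffeologicalSpace X] (g : T₂ X → ℝ) : Prop where
  tensor : ∀ P : Plot X, IsCovariantTwoTensor P.dom (fun x v w => g (T₂.mk P x v w))
  symm : ∀ (P : Plot X) (x : P.dom) (v w : Euc P.dim), g (T₂.mk P x v w) = g (T₂.mk P x w v)
  nonneg : ∀ (P : Plot X) (x : P.dom) (v : Euc P.dim), 0 ≤ g (T₂.mk P x v v)

/-- A smooth path `γ : ℝ → X`, regarded as a plot with domain `ℝ = ℝ^1`. -/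
def pathPlot {X : Type u} [DiffeologicalSpace X] (γ : SmoothMap ℝ X) : Plot X where
  dim := 1
  dom := univ
  isOpen_dom := isOpen_univ
  toFun := fun r => γ (r 0)
  isPlot_comp m f hf _ := by
    refine γ.2 m (fun t => f t 0) (ContDiff.isPlot ?_)
    fun_prop

/-- The number `g(γ)_t(1, 1)` for a smooth path `γ : ℝ → X`. -/
def speedSq {X : Type u} [DiffeologicalSpace X] (g : T₂ X → ℝ) (γ : SmoothMap ℝ X) (t : ℝ) : ℝ :=
  g (T₂.mk (pathPlot γ) ⟨EuclideanSpace.single (0 : Fin 1) t, mem_univ _⟩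
    (EuclideanSpace.single (0 : Fin 1) 1) (EuclideanSpace.single (0 : Fin 1) 1))

/-- The length `ℓ(γ) = ∫_0^1 (g(γ)_t(1, 1))^{1/2} dt`. -/
def pathLength {X : Type u} [DiffeologicalSpace X] (g : T₂ X → ℝ) (γ : SmoothMap ℝ X) : ℝ≥0∞ :=
  ∫⁻ t in Icc (0 : ℝ) 1, ENNReal.ofReal (Real.sqrt (speedSq g γ t))

/-- The pseudodistance defined by `g`: the infimum of the lengths of the smooth paths from `x` to
`y`. It is `∞` if there is no such path. -/
def pseudoDist {X : Type u} [DiffeologicalSpace X] (g : T₂ X → ℝ) (x y : X) : ℝ≥0∞ :=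
  ⨅ (γ : SmoothMap ℝ X) (_ : γ 0 = x) (_ : γ 1 = y), pathLength g γ

/-- A function with values in `[0, ∞]` is a distance (the value `∞` being allowed). -/
structure IsDistance {X : Type u} (d : X → X → ℝ≥0∞) : Prop where
  self : ∀ x, d x x = 0
  symm : ∀ x y, d x y = d y x
  triangle : ∀ x y z, d x z ≤ d x y + d y z
  eq_of_zero : ∀ x y, d x y = 0 → x = y

/-! ## Smooth manifolds as diffeological spaces, volume forms and their integral -/

/-- The standard diffeology of a smooth manifold `M`: plots are the smooth maps into `M`. -/
@[reducible]
def manifoldDiffeology (n : ℕ) (M : Type u) [TopologicalSpace M] [ChartedSpace (Euc n) M] :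
    DiffeologicalSpace M :=
  .ofCorePlotsOn {
    isPlotOn := fun {m w} _ p => ContMDiffOn (𝓡 m) (𝓡 n) ∞ p w
    isPlotOn_congr := fun _ _ _ h =>
      ⟨fun h1 => h1.congr fun x hx => (h hx).symm, fun h1 => h1.congr fun x hx => h hx⟩
    isPlot := fun {m} p => ContMDiff (𝓡 m) (𝓡 n) ∞ p
    isPlotOn_univ := contMDiffOn_univ
    isPlot_const := fun _ => contMDiff_const
    isPlotOn_reparam := fun _ _ _ h hp hf => hp.comp hf.contMDiffOn h.subset_preimage
    locality := fun _ _ h => fun x hxu => by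
      obtain ⟨v, hv, hxv, hv'⟩ := h x hxu
      exact ((hv' x hxv).contMDiffAt (hv.mem_nhds hxv)).contMDiffWithinAt }

/-- The coefficient `η(∂₁, …, ∂ₙ)` at the point with coordinates `y` of an `n`-form `η` in the
chart `e`, that is, `η = formCoeff η e dy₁ ∧ ⋯ ∧ dyₙ` in this chart. -/
def formCoeff {n : ℕ} {M : Type u} [TopologicalSpace M] [ChartedSpace (Euc n) M]
    (η : ∀ p : M, (TangentSpace (𝓡 n) p) [⋀^Fin n]→L[ℝ] ℝ) (e : OpenPartialHomeomorph M (Euc n))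
    (y : Euc n) : ℝ :=
  η (e.symm y) (fun i => mfderiv (𝓡 n) (𝓡 n) e.symm y (EuclideanSpace.single i (1 : ℝ)))

/-- A volume form on an `n`-dimensional manifold: a smooth `n`-form which vanishes nowhere. A
manifold is orientable iff it carries one; it is then oriented by requiring the form to be
positive. -/
structure VolumeForm (n : ℕ) (M : Type u) [TopologicalSpace M] [ChartedSpace (Euc n) M] where
  form : ∀ p : M, (TangentSpace (𝓡 n) p) [⋀^Fin n]→L[ℝ] ℝ
  smooth : ∀ e ∈ atlas (Euc n) M, ContDiffOn ℝ ∞ (formCoeff form e) e.target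
  ne_zero : ∀ p : M, form p ≠ 0

section Integral

variable {n : ℕ} {M : Type u} [TopologicalSpace M] [ChartedSpace (Euc n) M]
  [IsManifold (𝓡 n) ∞ M] [CompactSpace M] [T2Space M]

/-- A smooth partition of unity `(ρ_x)` with `ρ_x` supported in the source of the chart at `x`. -/
def chartPartition (n : ℕ) (M : Type u) [TopologicalSpace M] [ChartedSpace (Euc n) M]
    [IsManifold (𝓡 n) ∞ M] [CompactSpace M] [T2Space M] :
    SmoothPartitionOfUnity M (𝓡 n) M univ :=
  (SmoothPartitionOfUnity.exists_isSubordinate_chartAt_source (𝓡 n) M).choose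

theorem chartPartition_isSubordinate :
    (chartPartition n M).IsSubordinate (fun x => (chartAt (Euc n) x).source) :=
  (SmoothPartitionOfUnity.exists_isSubordinate_chartAt_source (𝓡 n) M).choose_spec

/-- The measure on `M` given by integration against a volume form `η`, for the orientation in which
`η` is positive. As usual, the integral is computed with a partition of unity `(ρ_x)` subordinate
to charts `φ_x`:
`∫_M f η = ∑_x ∫ (ρ_x f) (φ_x⁻¹ y) |η(∂₁, …, ∂ₙ)| dy` over the targets of the charts.
The absolute value accounts for the charts that are not positively oriented. -/
def VolumeForm.measure [MeasurableSpace M] (η : VolumeForm n M) : Measure M :=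
  Measure.sum fun x : M =>
    ((volume.restrict (chartAt (Euc n) x).target).withDensity fun y =>
      ENNReal.ofReal (chartPartition n M x ((chartAt (Euc n) x).symm y) *
        |formCoeff η.form (chartAt (Euc n) x) y|)).map (chartAt (Euc n) x).symm

end Integral

/-- The metric on `C^∞(X, Y)` induced by a metric `g` on `Y` and a measure on `X`:
`[r, v, w]_P ↦ ∫_X g(ev_x ∘ P)_r(v, w) dμ(x)`. -/
def mappingMetric {X : Type u} {Y : Type v} [DiffeologicalSpace X] [DiffeologicalSpace Y]
    [MeasurableSpace X] (μ : Measure X) (g : T₂ Y → ℝ) : T₂ (SmoothMap X Y) → ℝ :=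
  fun ξ => ∫ x, g (T₂.map (dSmooth_ev x) ξ) ∂μ

end RiemDiff

end

open RiemDiff

/-!
The metric of the mapping space is integrated from tensors that are smooth in all variables at
once. If `P` is a plot of `C^∞(M, N)` and `e` a chart of `M`, then `(r, y) ↦ P r (e⁻¹ y)` is a plot
of `N` (`Plot.inChart`), and `r ↦ (r, y)` is a morphism to it from the plot `ev_m ∘ P` with
`m = e⁻¹ y`. So the tensors `gN(ev_m ∘ P)` are, for `m` in the chart, restrictions of one smooth
tensor in `(r, y)` (`exists_tensor_inChart`). Hence the integrand is continuous in `m`, thus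
integrable over the compact manifold `M`, whose volume is finite. In charts the integral is a
finite sum of integrals over compact sets, and it is smooth in `r` because an integral against a
compactly supported weight is the value at `0` of a convolution (`contDiffOn_setIntegral_smul`).
Symmetry and positivity are inherited pointwise.

For any weak Riemannian metric, the pseudodistance vanishes on the diagonal, is symmetric and
satisfies the triangle inequality: use constant, reversed and concatenated paths, the latter after
a reparametrization by a smooth step function that makes them constant near the common endpoint.

It remains to see that `f = h` if `d_g(f, h) = 0`. Exchanging integrals and applying the
Cauchy-Schwarz inequality on `M` gives, for each path `γ` from `f` to `h`,
`∫_M ℓ(ev_m ∘ γ) dm ≤ vol(M)^{1/2} ℓ(γ)` (`lintegral_pathLength_evPath_le`). If `f c ≠ h c`, then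
`d(f c, h c) > 0`. Plots, hence smooth maps from `M`, are continuous for the pseudodistance of `N`
(`eventually_pseudoDist_plot_le`), so `d(f m, h m) ≥ ε > 0` for `m` in some open set `V ∋ c`. Since
`vol(V) > 0`, the lengths of the paths `γ` are bounded below by `ε vol(V) / vol(M)^{1/2} > 0`.
-/

namespace RiemDiff

/-! ### Germs of plots and the speed of a path -/

section Paths

variable {X : Type*} [DiffeologicalSpace X]

/-- The restriction of a plot to the intersection of its domain with an open set. -/
def Plot.restrict (P : Plot X) {V : Set (Euc P.dim)} (hV : IsOpen V) : Plot X where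
  dim := P.dim
  dom := P.dom ∩ V
  isOpen_dom := P.isOpen_dom.inter hV
  toFun := P.toFun
  isPlot_comp m f hf hm := P.isPlot_comp m f hf fun t => (hm t).1

theorem T₂.mk_congr (P : Plot X) {x x' : P.dom} {v v' w w' : Euc P.dim}
    (hx : (x : Euc P.dim) = x') (hv : v = v') (hw : w = w') :
    T₂.mk P x v w = T₂.mk P x' v' w' := by
  obtain rfl := Subtype.ext hx
  rw [hv, hw]

/-- The identification in `T₂(X)` along a morphism of plots that is only defined near the base
point: both plots are compared with the restriction of the first one. -/
theorem T₂.mk_eq_of_local (P Q : Plot X) {V : Set (Euc P.dim)} (hV : IsOpen V)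
    {h : Euc P.dim → Euc Q.dim} (hs : ContDiffOn ℝ ∞ h V) (hm : ∀ r ∈ V, h r ∈ Q.dom)
    (hc : ∀ r ∈ V, Q.toFun (h r) = P.toFun r) (x : P.dom) (hx : (x : Euc P.dim) ∈ V)
    (v w : Euc P.dim) :
    T₂.mk P x v w = T₂.mk Q ⟨h x, hm x hx⟩ (fderiv ℝ h x v) (fderiv ℝ h x w) := by
  have h1 : T₂.mk (P.restrict hV) ⟨x.1, x.2, hx⟩ v w = T₂.mk P x v w := by
    have := T₂Rel.mk (P.restrict hV) P (fun r => r) contDiff_id.contDiffOn (fun r hr => hr.1)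
      (fun r _ => rfl) ⟨x.1, x.2, hx⟩ v w
    have hid (u : Euc P.dim) : fderiv ℝ (fun r : Euc P.dim => r) x.1 u = u := by simp
    exact (Quot.sound this).trans (T₂.mk_congr P rfl (hid v) (hid w))
  have h2 := T₂Rel.mk (P.restrict hV) Q h (hs.mono fun r hr => hr.2) (fun r hr => hm r hr.2)
      (fun r hr => hc r hr.2) ⟨x.1, x.2, hx⟩ v w
  exact h1.symm.trans (Quot.sound h2)

/-- If a path factors near `t` through a plot `Q` by a curve `k`, then its speed is that of `k`,
measured in `Q`. -/
theorem speedSq_eq_of_local (g : T₂ X → ℝ) (γ : SmoothMap ℝ X) (Q : Plot X) {V : Set ℝ}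
    (hV : IsOpen V) {k : ℝ → Euc Q.dim} (hs : ContDiffOn ℝ ∞ k V) (hm : ∀ t ∈ V, k t ∈ Q.dom)
    (hc : ∀ t ∈ V, Q.toFun (k t) = γ t) {t : ℝ} (ht : t ∈ V) :
    speedSq g γ t = g (T₂.mk Q ⟨k t, hm t ht⟩ (deriv k t) (deriv k t)) := by
  set x : Euc 1 := EuclideanSpace.single (0 : Fin 1) t with hxdef
  have hx : x 0 = t := by simp [x]
  have hV' : IsOpen ((fun r : Euc 1 => r 0) ⁻¹' V) := hV.preimage (by fun_prop)
  have hcd : ContDiffOn ℝ ∞ (fun r : Euc 1 => k (r 0)) ((fun r : Euc 1 => r 0) ⁻¹' V) :=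
    hs.comp (by fun_prop) fun r hr => hr
  have hd : HasFDerivAt (fun r : Euc 1 => k (r 0))
      (((1 : ℝ →L[ℝ] ℝ).smulRight (deriv k t)).comp (EuclideanSpace.proj (0 : Fin 1))) x := by
    have h1 : HasFDerivAt k ((1 : ℝ →L[ℝ] ℝ).smulRight (deriv k t))
        ((EuclideanSpace.proj (0 : Fin 1) : Euc 1 →L[ℝ] ℝ) x) := by
      have : (EuclideanSpace.proj (0 : Fin 1) : Euc 1 →L[ℝ] ℝ) x = t := hx
      rw [this]
      exact (((hs t ht).contDiffAt (hV.mem_nhds ht)).differentiableAt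
        (by simp)).hasDerivAt.hasFDerivAt
    exact h1.comp x (EuclideanSpace.proj (0 : Fin 1) : Euc 1 →L[ℝ] ℝ).hasFDerivAt
  have hd' : fderiv ℝ (fun r : Euc 1 => k (r 0)) x (EuclideanSpace.single (0 : Fin 1) 1)
      = deriv k t := by
    rw [hd.fderiv]; simp
  have key := T₂.mk_eq_of_local (pathPlot γ) Q hV' hcd (fun r hr => hm _ hr)
    (fun r hr => hc _ hr) ⟨x, mem_univ _⟩ (show x 0 ∈ V from hx.symm ▸ ht)
    (EuclideanSpace.single (0 : Fin 1) 1) (EuclideanSpace.single (0 : Fin 1) 1)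
  exact congrArg g (key.trans (T₂.mk_congr Q (congrArg k hx) hd' hd'))

variable {g : T₂ X → ℝ}

theorem euc_single_eq_smul :
    (fun t : ℝ => (EuclideanSpace.single (0 : Fin 1) t : Euc 1)) =
      fun t => t • EuclideanSpace.single (0 : Fin 1) 1 := by
  funext t; ext i; simp

theorem speedSq_nonneg (hg : IsWeakRiemannianMetric g) (γ : SmoothMap ℝ X) (t : ℝ) :
    0 ≤ speedSq g γ t :=
  hg.nonneg _ _ _

theorem continuous_speedSq (hg : IsWeakRiemannianMetric g) (γ : SmoothMap ℝ X) :
    Continuous (speedSq g γ) := by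
  obtain ⟨B, hB, hBe⟩ := hg.tensor (pathPlot γ)
  have hB' : Continuous B := by
    rw [← continuousOn_univ]; exact hB.continuousOn
  have : speedSq g γ = fun t => B (EuclideanSpace.single (0 : Fin 1) t)
      (EuclideanSpace.single (0 : Fin 1) 1) (EuclideanSpace.single (0 : Fin 1) 1) :=
    funext fun t => hBe ⟨_, mem_univ _⟩ _ _
  rw [this]
  have h1 : Continuous fun t : ℝ => (EuclideanSpace.single (0 : Fin 1) t : Euc 1) := by
    rw [euc_single_eq_smul]; fun_prop
  exact ((hB'.comp h1).clm_apply continuous_const).clm_apply continuous_const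

theorem pathLength_eq_ofReal (hg : IsWeakRiemannianMetric g) (γ : SmoothMap ℝ X) :
    pathLength g γ = ENNReal.ofReal (∫ t in (0 : ℝ)..1, √(speedSq g γ t)) := by
  have hc : Continuous fun t => √(speedSq g γ t) := (continuous_speedSq hg γ).sqrt
  rw [pathLength, intervalIntegral.integral_of_le zero_le_one, ← integral_Icc_eq_integral_Ioc,
    ofReal_integral_eq_lintegral_ofReal hc.continuousOn.integrableOn_Icc
      (Filter.Eventually.of_forall fun t => Real.sqrt_nonneg _)]

/-- Reparametrization by `k` multiplies the speed by `|k'|`. -/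
theorem speedSq_reparam (hg : IsWeakRiemannianMetric g) (γ γ' : SmoothMap ℝ X) {V : Set ℝ}
    (hV : IsOpen V) {k : ℝ → ℝ} (hs : ContDiff ℝ ∞ k) (hc : ∀ t ∈ V, γ' (k t) = γ t) {t : ℝ}
    (ht : t ∈ V) : speedSq g γ t = deriv k t ^ 2 * speedSq g γ' (k t) := by
  have hk : ContDiff ℝ ∞ (fun t => (EuclideanSpace.single (0 : Fin 1) (k t) : Euc 1)) := by
    rw [contDiff_euclidean]
    intro i
    fin_cases i
    simpa using hs
  have h1 := speedSq_eq_of_local g γ (pathPlot γ') hV (k := fun t =>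
    (EuclideanSpace.single (0 : Fin 1) (k t) : Euc 1)) hk.contDiffOn (fun _ _ => mem_univ _)
    (fun t ht => by simpa [pathPlot] using hc t ht) ht
  have hd : deriv (fun t => (EuclideanSpace.single (0 : Fin 1) (k t) : Euc 1)) t
      = deriv k t • EuclideanSpace.single (0 : Fin 1) (1 : ℝ) := by
    have h2 : (fun t => (EuclideanSpace.single (0 : Fin 1) (k t) : Euc 1))
        = fun t => k t • EuclideanSpace.single (0 : Fin 1) (1 : ℝ) :=
      funext fun t => congrFun euc_single_eq_smul (k t)
    rw [h2, deriv_smul_const (hs.differentiable (by simp) t)]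
  obtain ⟨B, -, hBe⟩ := hg.tensor (pathPlot γ')
  have h3 : speedSq g γ' (k t) = B (EuclideanSpace.single (0 : Fin 1) (k t))
      (EuclideanSpace.single (0 : Fin 1) (1 : ℝ)) (EuclideanSpace.single (0 : Fin 1) (1 : ℝ)) :=
    hBe ⟨_, mem_univ _⟩ _ _
  have h4 (β : Euc 1 →L[ℝ] Euc 1 →L[ℝ] ℝ) (c : ℝ) (u : Euc 1) :
      β (c • u) (c • u) = c ^ 2 * β u u := by
    simp only [map_smul, smul_apply, smul_eq_mul]
    ring
  rw [h3]
  exact ((h1.trans (congrArg g (T₂.mk_congr (pathPlot γ') rfl hd hd))).trans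
    (hBe ⟨_, mem_univ _⟩ _ _)).trans (h4 _ _ _)

/-- Being smooth is a local property of maps `ℝ → X`. -/
theorem dSmooth_of_locally_eq {f : ℝ → X}
    (h : ∀ t, ∃ V : Set ℝ, IsOpen V ∧ t ∈ V ∧ ∃ f' : ℝ → X, DSmooth f' ∧ EqOn f f' V) :
    DSmooth f := by
  intro m p hp
  refine DiffeologicalSpace.locality fun x => ?_
  obtain ⟨V, hV, hxV, f', hf', he⟩ := h (p x)
  refine ⟨p ⁻¹' V, hV.preimage hp.contDiff.continuous, hxV, fun {k q} hq hqs => ?_⟩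
  have h1 : (f ∘ p) ∘ q = f' ∘ (p ∘ q) := funext fun s => he (hq s)
  rw [h1]
  exact hf' k _ (isPlot_reparam hp hqs)

/-! ### The pseudodistance of a weak Riemannian metric -/

theorem pseudoDist_le_pathLength (g : T₂ X → ℝ) (γ : SmoothMap ℝ X) :
    pseudoDist g (γ 0) (γ 1) ≤ pathLength g γ :=
  iInf_le_of_le γ (iInf_le_of_le rfl (iInf_le_of_le rfl le_rfl))

theorem pseudoDist_self (hg : IsWeakRiemannianMetric g) (x : X) : pseudoDist g x x = 0 := by
  let γ : SmoothMap ℝ X := ⟨fun _ => x, dSmooth_const⟩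
  refine le_antisymm ((pseudoDist_le_pathLength g γ).trans_eq ?_) zero_le
  have h (t : ℝ) : speedSq g γ t = 0 := by
    rw [speedSq_reparam hg γ γ isOpen_univ (contDiff_const (c := (0 : ℝ))) (fun _ _ => rfl)
      (mem_univ t)]
    simp
  simp [pathLength, h]

theorem pseudoDist_comm_le (hg : IsWeakRiemannianMetric g) (x y : X) :
    pseudoDist g x y ≤ pseudoDist g y x := by
  refine le_iInf fun γ => le_iInf fun h0 => le_iInf fun h1 => ?_
  have hk : ContDiff ℝ ∞ fun t : ℝ => 1 - t := by fun_prop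
  let γ' : SmoothMap ℝ X := ⟨fun t => γ (1 - t), γ.2.comp hk.dSmooth⟩
  have h (t : ℝ) : speedSq g γ' t = speedSq g γ (1 - t) := by
    rw [speedSq_reparam hg γ' γ isOpen_univ hk (fun _ _ => rfl) (mem_univ t)]
    simp
  have hl : pathLength g γ' = pathLength g γ := by
    rw [pathLength_eq_ofReal hg, pathLength_eq_ofReal hg]
    simp only [h]
    rw [intervalIntegral.integral_comp_sub_left (fun t => √(speedSq g γ t))]
    simp
  rw [← hl]
  have := pseudoDist_le_pathLength g γ'
  simpa [γ', h0, h1] using this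

theorem pseudoDist_comm (hg : IsWeakRiemannianMetric g) (x y : X) :
    pseudoDist g x y = pseudoDist g y x :=
  le_antisymm (pseudoDist_comm_le hg x y) (pseudoDist_comm_le hg y x)

/-- The length of a path is unchanged by a monotone reparametrization. -/
theorem integral_sqrt_speedSq_reparam (hg : IsWeakRiemannianMetric g) (γ γ' : SmoothMap ℝ X)
    {V : Set ℝ} (hV : IsOpen V) {k : ℝ → ℝ} (hs : ContDiff ℝ ∞ k) (hk : Monotone k)
    (hc : ∀ t ∈ V, γ' (k t) = γ t) {a b : ℝ} (hab : uIcc a b ⊆ V) :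
    ∫ t in a..b, √(speedSq g γ t) = ∫ t in k a..k b, √(speedSq g γ' t) := by
  rw [← intervalIntegral.integral_comp_mul_deriv (f := k) (f' := deriv k)
    (g := fun t => √(speedSq g γ' t))
    (fun x _ => (hs.differentiable (by simp) x).hasDerivAt)
    (hs.continuous_deriv (by simp)).continuousOn (continuous_speedSq hg γ').sqrt]
  refine intervalIntegral.integral_congr fun t ht => ?_
  simp only [Function.comp]
  rw [speedSq_reparam hg γ γ' hV hs hc (hab ht), Real.sqrt_mul (sq_nonneg _),
    Real.sqrt_sq hk.deriv_nonneg, mul_comm]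

/-- Two paths with a common endpoint can be concatenated smoothly, once both are made constant
near this endpoint by means of a smooth step function. -/
theorem pseudoDist_triangle (hg : IsWeakRiemannianMetric g) (x y z : X) :
    pseudoDist g x z ≤ pseudoDist g x y + pseudoDist g y z := by
  unfold pseudoDist
  simp only [ENNReal.iInf_add, ENNReal.add_iInf]
  refine le_iInf fun γ₂ => le_iInf fun h20 => le_iInf fun h21 => le_iInf fun γ₁ =>
    le_iInf fun h10 => le_iInf fun h11 => ?_
  -- `k₁` runs from `0` to `1` on `[0, 1/3]` and `k₂` on `[2/3, 1]`; both are constant elsewhere.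
  let k₁ : ℝ → ℝ := fun t => Real.smoothTransition (3 * t)
  let k₂ : ℝ → ℝ := fun t => Real.smoothTransition (3 * t - 2)
  have hk₁ : ContDiff ℝ ∞ k₁ := Real.smoothTransition.contDiff.comp (by fun_prop)
  have hk₂ : ContDiff ℝ ∞ k₂ := Real.smoothTransition.contDiff.comp (by fun_prop)
  have hm₁ : Monotone k₁ := fun s t hst => Real.smoothTransition.monotone (by linarith)
  have hm₂ : Monotone k₂ := fun s t hst => Real.smoothTransition.monotone (by linarith)
  let f : ℝ → X := fun t => if t ≤ 1 / 2 then γ₁ (k₁ t) else γ₂ (k₂ t)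
  have hf₁ : EqOn f (fun t => γ₁ (k₁ t)) (Iio (2 / 3)) := by
    intro t ht
    simp only [f]
    split_ifs with h
    · rfl
    · have e1 : k₁ t = 1 := Real.smoothTransition.one_of_one_le (by linarith)
      have e2 : k₂ t = 0 := Real.smoothTransition.zero_of_nonpos (by
        have : t < 2 / 3 := ht
        linarith)
      simp [e1, e2, h11, h20]
  have hf₂ : EqOn f (fun t => γ₂ (k₂ t)) (Ioi (1 / 3)) := by
    intro t ht
    simp only [f]
    split_ifs with h
    · have e1 : k₁ t = 1 := Real.smoothTransition.one_of_one_le (by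
        have : 1 / 3 < t := ht
        linarith)
      have e2 : k₂ t = 0 := Real.smoothTransition.zero_of_nonpos (by linarith)
      simp [e1, e2, h11, h20]
    · rfl
  have hfs : DSmooth f := by
    refine dSmooth_of_locally_eq fun t => ?_
    rcases lt_or_ge t (2 / 3) with h | h
    · exact ⟨_, isOpen_Iio, h, _, γ₁.2.comp hk₁.dSmooth, hf₁⟩
    · exact ⟨_, isOpen_Ioi, show (1 / 3 : ℝ) < t by linarith, _, γ₂.2.comp hk₂.dSmooth, hf₂⟩
  let γ : SmoothMap ℝ X := ⟨f, hfs⟩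
  have h0 : γ 0 = x := by
    have : k₁ 0 = 0 := Real.smoothTransition.zero_of_nonpos (by norm_num)
    exact (hf₁ (show (0 : ℝ) < 2 / 3 by norm_num)).trans (by simp [this, h10])
  have h1 : γ 1 = z := by
    have : k₂ 1 = 1 := Real.smoothTransition.one_of_one_le (by norm_num)
    exact (hf₂ (show (1 / 3 : ℝ) < 1 by norm_num)).trans (by simp [this, h21])
  refine iInf_le_of_le γ (iInf_le_of_le h0 (iInf_le_of_le h1 ?_))
  have hc : Continuous fun t => √(speedSq g γ t) := (continuous_speedSq hg γ).sqrt
  have hi (γ : SmoothMap ℝ X) : 0 ≤ ∫ t in (0 : ℝ)..1, √(speedSq g γ t) :=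
    intervalIntegral.integral_nonneg zero_le_one fun _ _ => Real.sqrt_nonneg _
  rw [pathLength_eq_ofReal hg, pathLength_eq_ofReal hg, pathLength_eq_ofReal hg,
    ← ENNReal.ofReal_add (hi _) (hi _),
    ← intervalIntegral.integral_add_adjacent_intervals (hc.intervalIntegrable 0 (1 / 2))
      (hc.intervalIntegrable (1 / 2) 1),
    integral_sqrt_speedSq_reparam hg γ γ₁ isOpen_Iio hk₁ hm₁ (fun t ht => (hf₁ ht).symm)
      (by rw [uIcc_of_le (by norm_num)]; exact fun t ht => lt_of_le_of_lt ht.2 (by norm_num)),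
    integral_sqrt_speedSq_reparam hg γ γ₂ isOpen_Ioi hk₂ hm₂ (fun t ht => (hf₂ ht).symm)
      (by rw [uIcc_of_le (by norm_num)]; exact fun t ht => lt_of_lt_of_le (by norm_num) ht.1)]
  have a1 : k₁ 0 = 0 := Real.smoothTransition.zero_of_nonpos (by norm_num)
  have a2 : k₁ (1 / 2) = 1 := Real.smoothTransition.one_of_one_le (by norm_num)
  have a3 : k₂ (1 / 2) = 0 := Real.smoothTransition.zero_of_nonpos (by norm_num)
  have a4 : k₂ 1 = 1 := Real.smoothTransition.one_of_one_le (by norm_num)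
  rw [a1, a2, a3, a4]

/-- Plots are continuous for the pseudodistance: a point near `x` in the domain of a plot is
joined to `x` by a segment, whose image has small length. -/
theorem eventually_pseudoDist_plot_le (hg : IsWeakRiemannianMetric g) (Q : Plot X)
    {x : Euc Q.dim} (hx : x ∈ Q.dom) {ε : ℝ} (hε : 0 < ε) :
    ∀ᶠ y in 𝓝 x, pseudoDist g (Q.toFun x) (Q.toFun y) ≤ ENNReal.ofReal ε := by
  obtain ⟨B, hB, hBe⟩ := hg.tensor Q
  have hBc : ContinuousAt B x := hB.continuousOn.continuousAt (Q.isOpen_dom.mem_nhds hx)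
  obtain ⟨C, hC0, hC⟩ : ∃ C : ℝ, 0 < C ∧ ∀ᶠ y in 𝓝 x, ‖B y‖ < C :=
    ⟨‖B x‖ + 1, by positivity, (ContinuousAt.norm (E := Euc Q.dim →L[ℝ] Euc Q.dim →L[ℝ] ℝ) hBc).eventually_lt_const
      (lt_add_one _)⟩
  obtain ⟨δ, hδ, hball⟩ := Metric.eventually_nhds_iff_ball.1
    (hC.and (Q.isOpen_dom.eventually_mem hx))
  have hst : ContDiff ℝ ∞ Real.smoothTransition := Real.smoothTransition.contDiff
  obtain ⟨L, hL⟩ := (isCompact_Icc (a := (0 : ℝ)) (b := 1)).exists_bound_of_continuousOn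
    (hst.continuous_deriv (by simp)).continuousOn
  have hL0 : 0 ≤ L := (norm_nonneg _).trans (hL 0 (by simp))
  have hlim : ∀ᶠ y in 𝓝 x, √C * (L * ‖y - x‖) < ε := by
    have : Filter.Tendsto (fun y => √C * (L * ‖y - x‖)) (𝓝 x) (𝓝 (√C * (L * ‖x - x‖))) :=
      Continuous.tendsto (by fun_prop) x
    exact this.eventually (gt_mem_nhds (by simpa using hε))
  filter_upwards [hlim, Metric.ball_mem_nhds x hδ] with y hy hyb
  -- The smooth step function keeps the whole path, defined on all of `ℝ`, on the segment.
  let k : ℝ → Euc Q.dim := fun t => x + Real.smoothTransition t • (y - x)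
  have hks : ContDiff ℝ ∞ k := contDiff_const.add (hst.smul contDiff_const)
  have hkb (t : ℝ) : k t ∈ Metric.ball x δ := by
    have : ‖Real.smoothTransition t • (y - x)‖ ≤ ‖y - x‖ := by
      rw [norm_smul, Real.norm_of_nonneg (Real.smoothTransition.nonneg t)]
      exact mul_le_of_le_one_left (norm_nonneg _) (Real.smoothTransition.le_one t)
    rw [mem_ball_iff_norm] at hyb ⊢
    simpa [k] using this.trans_lt hyb
  have hkd (t : ℝ) : k t ∈ Q.dom := (hball _ (hkb t)).2
  let γ : SmoothMap ℝ X := ⟨fun t => Q.toFun (k t), fun m p hp =>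
    Q.isPlot_comp m (fun s => k (p s)) (hks.comp hp.contDiff) fun s => hkd _⟩
  have hder (t : ℝ) : deriv k t = deriv Real.smoothTransition t • (y - x) := by
    simp only [k, deriv_const_add]
    rw [deriv_smul_const (hst.differentiable (by simp) t)]
  have hsp (t : ℝ) (ht : t ∈ Icc (0 : ℝ) 1) : √(speedSq g γ t) ≤ √C * (L * ‖y - x‖) := by
    have e := speedSq_eq_of_local g γ Q isOpen_univ hks.contDiffOn (fun t _ => hkd t)
      (fun _ _ => rfl) (mem_univ t)
    have hdn : ‖deriv k t‖ ≤ L * ‖y - x‖ := by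
      rw [hder, norm_smul]
      exact mul_le_mul_of_nonneg_right (hL t ht) (norm_nonneg _)
    have hle : speedSq g γ t ≤ C * (L * ‖y - x‖) ^ 2 := by
      rw [e]
      refine (hBe ⟨k t, hkd t⟩ _ _).trans_le ((le_abs_self _).trans (((B (k t)).le_opNorm₂ _ _).trans ?_))
      rw [mul_assoc, sq]
      have := (hball _ (hkb t)).1.le
      gcongr
    refine (Real.sqrt_le_sqrt hle).trans_eq ?_
    rw [Real.sqrt_mul hC0.le, Real.sqrt_sq (by positivity)]
  have hγ0 : γ 0 = Q.toFun x := by simp [γ, k]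
  have hγ1 : γ 1 = Q.toFun y := by simp [γ, k]
  rw [← hγ0, ← hγ1]
  refine (pseudoDist_le_pathLength g γ).trans ?_
  rw [pathLength]
  refine (setLIntegral_mono' measurableSet_Icc (g := fun _ => ENNReal.ofReal ε) fun t ht =>
    ENNReal.ofReal_le_ofReal ((hsp t ht).trans hy.le)).trans_eq ?_
  simp

end Paths

end RiemDiff

namespace RiemDiff

/-! ### Smoothness of integrals depending on a parameter -/

/-- Integration over `V` of a smooth function of `(p, y)` against a weight `w y * a y` that
vanishes off a compact subset of `V` is smooth in `p`: the integral is the value at `0` of the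
convolution of the (merely continuous) factor `a` with a smooth compactly supported function. -/
theorem contDiffOn_setIntegral_smul {F G E : Type*}
    [NormedAddCommGroup F] [NormedSpace ℝ F] [NormedAddCommGroup G] [NormedSpace ℝ G]
    [FiniteDimensional ℝ G] [MeasurableSpace G] [BorelSpace G] (μ : Measure G)
    [IsFiniteMeasureOnCompacts μ] [NormedAddCommGroup E] [NormedSpace ℝ E]
    {s : Set F} (hs : IsOpen s) {V K : Set G} (hV : IsOpen V) (hK : IsCompact K) (hKV : K ⊆ V)
    {w : G → ℝ} (hw : ContDiffOn ℝ ∞ w V) (hw0 : ∀ y ∈ V, y ∉ K → w y = 0)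
    {a : G → ℝ} (ha : ContinuousOn a V) {B : F × G → E} (hB : ContDiffOn ℝ ∞ B (s ×ˢ V)) :
    ContDiffOn ℝ ∞ (fun p => ∫ y in V, (w y * a y) • B (p, y) ∂μ) s := by
  -- The sign makes `g p (0 - y)`, as it occurs in the convolution at `0`, a function of `y`.
  let g : F → G → E := fun p u => V.indicator (fun y => w y • B (p, y)) (-u)
  have hgs : ∀ p u, p ∈ s → u ∉ -K → g p u = 0 := by
    intro p u _ hu
    by_cases hV' : -u ∈ V
    · have : -u ∉ K := fun h => hu h
      simp [g, hV', hw0 _ hV' this]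
    · simp [g, hV']
  have hf : LocallyIntegrable (K.indicator a) μ :=
    ((integrable_indicator_iff hK.measurableSet).2
      ((ha.mono hKV).integrableOn_compact hK)).locallyIntegrable
  have hg : ContDiffOn ℝ ∞ (Function.uncurry g) (s ×ˢ univ) := by
    rintro ⟨p, u⟩ ⟨hp, -⟩
    refine ContDiffAt.contDiffWithinAt ?_
    by_cases hu : -u ∈ V
    · have hsm : ContDiffOn ℝ ∞ (fun q : F × G => w (-q.2) • B (q.1, -q.2))
          (s ×ˢ ((fun u : G => -u) ⁻¹' V)) := by
        refine ContDiffOn.smul (hw.comp (by fun_prop) fun q hq => hq.2) ?_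
        exact hB.comp (f := fun q : F × G => (q.1, -q.2)) (by fun_prop) fun q hq => ⟨hq.1, hq.2⟩
      have hopen : IsOpen (s ×ˢ ((fun u : G => -u) ⁻¹' V)) :=
        hs.prod (hV.preimage continuous_neg)
      refine ((hsm _ ⟨hp, hu⟩).contDiffAt (hopen.mem_nhds ⟨hp, hu⟩)).congr_of_eventuallyEq ?_
      filter_upwards [hopen.mem_nhds (show (p, u) ∈ _ from ⟨hp, hu⟩)] with q hq
      exact indicator_of_mem (show -q.2 ∈ V from hq.2) (fun y => w y • B (q.1, y))
    · have hopen : IsOpen (s ×ˢ ((fun u : G => -u) ⁻¹' Kᶜ)) :=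
        hs.prod (hK.isClosed.isOpen_compl.preimage continuous_neg)
      refine (contDiffAt_const (c := (0 : E))).congr_of_eventuallyEq ?_
      filter_upwards [hopen.mem_nhds (show (p, u) ∈ _ from ⟨hp, fun h => hu (hKV h)⟩)] with q hq
      exact hgs q.1 q.2 hq.1 fun h => hq.2 h
  have key := contDiffOn_convolution_right_with_param (μ := μ) (n := ⊤)
    (ContinuousLinearMap.lsmul ℝ ℝ (E := E)) hs hK.neg hgs hf hg
  have key2 := key.comp (f := fun p : F => (p, (0 : G))) (by fun_prop) fun p hp => ⟨hp, trivial⟩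
  refine key2.congr fun p hp => ?_
  simp only [Function.comp, convolution_def, ContinuousLinearMap.lsmul_apply, zero_sub, g, neg_neg]
  rw [← integral_indicator hV.measurableSet]
  congr 1
  funext y
  by_cases hy : y ∈ V
  · by_cases hyK : y ∈ K
    · simp [hy, hyK, smul_smul, mul_comm]
    · simp [hy, hyK, hw0 y hy hyK]
  · simp [hy]

/-! ### The measure of a volume form -/

section Volume

variable {n : ℕ} {M : Type*} [TopologicalSpace M] [ChartedSpace (Euc n) M]

theorem VolumeForm.continuousOn_abs_formCoeff (η : VolumeForm n M) (x : M) :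
    ContinuousOn (fun y => |formCoeff η.form (chartAt (Euc n) x) y|)
      (chartAt (Euc n) x).target :=
  (η.smooth _ (chart_mem_atlas _ x)).continuousOn.abs

variable [IsManifold (𝓡 n) ∞ M]

/-- The coefficient of a volume form in a chart does not vanish: the chart sends the standard
basis to a basis of the tangent space. -/
theorem VolumeForm.formCoeff_ne_zero (η : VolumeForm n M) {e : OpenPartialHomeomorph M (Euc n)}
    (he : e ∈ atlas (Euc n) M) {y : Euc n} (hy : y ∈ e.target) : formCoeff η.form e y ≠ 0 := by
  have : IsManifold (𝓡 n) 1 M := .of_le (n := ∞) (by simp)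
  have hd : e.symm.MDifferentiable (𝓡 n) (𝓡 n) := (mdifferentiable_of_mem_atlas he).symm
  let L : Euc n ≃L[ℝ] TangentSpace (𝓡 n) (e.symm y) := hd.mfderiv hy
  let b : Module.Basis (Fin n) ℝ (TangentSpace (𝓡 n) (e.symm y)) :=
    (EuclideanSpace.basisFun (Fin n) ℝ).toBasis.map L.toLinearEquiv
  have hb : (b : Fin n → TangentSpace (𝓡 n) (e.symm y)) =
      fun i => mfderiv (𝓡 n) (𝓡 n) e.symm y (EuclideanSpace.single i (1 : ℝ)) := by
    funext i
    simp [b]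
    rfl
  have := (AlternatingMap.map_basis_ne_zero_iff b (η.form (e.symm y)).toAlternatingMap).2
    (fun h => η.ne_zero _ (ContinuousAlternatingMap.toAlternatingMap_injective h))
  rw [hb] at this
  exact this

variable [CompactSpace M] [T2Space M]

/-- The density on the target of the chart at `x` of the part of the measure of `η` that this
chart contributes. -/
noncomputable def VolumeForm.chartDensity (η : VolumeForm n M) (x : M) (y : Euc n) : ℝ :=
  chartPartition n M x ((chartAt (Euc n) x).symm y) * |formCoeff η.form (chartAt (Euc n) x) y|

/-- The image in the chart at `x` of the support of the partition function `ρ_x`. -/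
def chartSupport (n : ℕ) {M : Type*} [TopologicalSpace M] [ChartedSpace (Euc n) M]
    [IsManifold (𝓡 n) ∞ M] [CompactSpace M] [T2Space M] (x : M) : Set (Euc n) :=
  chartAt (Euc n) x '' tsupport (chartPartition n M x)

theorem isCompact_chartSupport (x : M) : IsCompact (chartSupport n x) :=
  (isClosed_tsupport _).isCompact.image_of_continuousOn
    ((chartAt (Euc n) x).continuousOn.mono (chartPartition_isSubordinate x))

theorem chartSupport_subset_target (x : M) :
    chartSupport n x ⊆ (chartAt (Euc n) x).target := by
  rintro _ ⟨m, hm, rfl⟩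
  exact (chartAt (Euc n) x).map_source (chartPartition_isSubordinate x hm)

theorem chartPartition_symm_eq_zero {x : M} {y : Euc n} (hy : y ∈ (chartAt (Euc n) x).target)
    (hyK : y ∉ chartSupport n x) :
    chartPartition n M x ((chartAt (Euc n) x).symm y) = 0 := by
  by_contra h
  exact hyK ⟨_, subset_tsupport _ h, (chartAt (Euc n) x).right_inv hy⟩

theorem contDiffOn_chartPartition_symm (x : M) :
    ContDiffOn ℝ ∞ (fun y => chartPartition n M x ((chartAt (Euc n) x).symm y))
      (chartAt (Euc n) x).target :=
  ((chartPartition n M x).contMDiff.comp_contMDiffOn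
    (contMDiffOn_chart_symm (I := 𝓡 n))).contDiffOn

theorem VolumeForm.continuousOn_chartDensity (η : VolumeForm n M) (x : M) :
    ContinuousOn (η.chartDensity x) (chartAt (Euc n) x).target :=
  (contDiffOn_chartPartition_symm x).continuousOn.mul (η.continuousOn_abs_formCoeff x)

theorem VolumeForm.chartDensity_nonneg (η : VolumeForm n M) (x : M) (y : Euc n) :
    0 ≤ η.chartDensity x y :=
  mul_nonneg ((chartPartition n M).nonneg _ _) (abs_nonneg _)

theorem VolumeForm.integrableOn_chartDensity_smul (η : VolumeForm n M) (x : M) {E : Type*}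
    [NormedAddCommGroup E] [NormedSpace ℝ E] {f : Euc n → E}
    (hf : ContinuousOn f (chartAt (Euc n) x).target) :
    IntegrableOn (fun y => η.chartDensity x y • f y) (chartAt (Euc n) x).target := by
  refine IntegrableOn.of_forall_sdiff_eq_zero (s := chartSupport n x)
    ((((η.continuousOn_chartDensity x).smul hf).mono
      (chartSupport_subset_target x)).integrableOn_compact (isCompact_chartSupport x))
    (chartAt (Euc n) x).open_target.measurableSet ?_
  rintro y ⟨hy, hyK⟩
  simp [chartDensity, chartPartition_symm_eq_zero hy hyK]

theorem finite_chartPartition_ne_zero :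
    {x : M | (Function.support (chartPartition n M x)).Nonempty}.Finite :=
  (chartPartition n M).locallyFinite.finite_nonempty_of_compact

theorem VolumeForm.aemeasurable_chartDensity (η : VolumeForm n M) (x : M) :
    AEMeasurable (fun y => ENNReal.ofReal (η.chartDensity x y))
      (volume.restrict (chartAt (Euc n) x).target) :=
  ((η.continuousOn_chartDensity x).aemeasurable
    (chartAt (Euc n) x).open_target.measurableSet).ennreal_ofReal

variable [MeasurableSpace M]

/-- The part of the measure of `η` that the chart at `x` contributes. -/
noncomputable def VolumeForm.chartMeasure (η : VolumeForm n M) (x : M) : Measure M :=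
  ((volume.restrict (chartAt (Euc n) x).target).withDensity fun y =>
    ENNReal.ofReal (η.chartDensity x y)).map (chartAt (Euc n) x).symm

theorem VolumeForm.measure_eq_sum (η : VolumeForm n M) :
    η.measure = Measure.sum η.chartMeasure :=
  rfl

/-- Compactness of `M` makes the sum over the charts finite. -/
theorem VolumeForm.measure_eq_finset_sum (η : VolumeForm n M) :
    η.measure = ∑ x ∈ (finite_chartPartition_ne_zero (n := n) (M := M)).toFinset,
      η.chartMeasure x := by
  rw [η.measure_eq_sum]
  ext s hs
  rw [Measure.sum_apply _ hs, Measure.finsetSum_apply]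
  refine tsum_eq_sum fun x hx => ?_
  have h0 : ∀ m, chartPartition n M x m = 0 := by
    by_contra! h
    obtain ⟨m, hm⟩ := h
    exact hx (by simpa [Function.ne_iff] using ⟨m, hm⟩)
  simp [chartMeasure, chartDensity, h0]

instance (η : VolumeForm n M) (x : M) : IsFiniteMeasure (η.chartMeasure x) := by
  have h := (η.integrableOn_chartDensity_smul x (f := fun _ => (1 : ℝ)) continuousOn_const)
  simp only [smul_eq_mul, mul_one] at h
  have := isFiniteMeasure_withDensity_ofReal h.hasFiniteIntegral
  unfold VolumeForm.chartMeasure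
  infer_instance

instance (η : VolumeForm n M) : IsFiniteMeasure η.measure := by
  rw [η.measure_eq_finset_sum]
  infer_instance

variable [BorelSpace M]

/-- The inverse of a chart is measurable on the target, off which it has junk values. -/
theorem VolumeForm.aemeasurable_chart_symm (η : VolumeForm n M) (x : M) :
    AEMeasurable (chartAt (Euc n) x).symm
      ((volume.restrict (chartAt (Euc n) x).target).withDensity fun y =>
        ENNReal.ofReal (η.chartDensity x y)) :=
  ((chartAt (Euc n) x).continuousOn_symm.aemeasurable
    (chartAt (Euc n) x).open_target.measurableSet).mono_ac (withDensity_absolutelyContinuous _ _)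

theorem VolumeForm.integrable_of_continuous (η : VolumeForm n M) {f : M → ℝ}
    (hf : Continuous f) : Integrable f η.measure := by
  rw [← integrableOn_univ]
  exact hf.continuousOn.integrableOn_compact isCompact_univ

/-- The integral of a continuous function, computed in charts. -/
theorem VolumeForm.integral_eq_sum (η : VolumeForm n M) {f : M → ℝ} (hf : Continuous f) :
    ∫ m, f m ∂η.measure = ∑ x ∈ (finite_chartPartition_ne_zero (n := n) (M := M)).toFinset,
      ∫ y in (chartAt (Euc n) x).target,
        η.chartDensity x y • f ((chartAt (Euc n) x).symm y) := by
  have hi (x : M) : Integrable f (η.chartMeasure x) := by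
    rw [← integrableOn_univ]
    exact hf.continuousOn.integrableOn_compact isCompact_univ
  rw [η.measure_eq_finset_sum, integral_finsetSum_measure fun x _ => hi x]
  refine Finset.sum_congr rfl fun x _ => ?_
  rw [chartMeasure, integral_map (η.aemeasurable_chart_symm x) hf.aestronglyMeasurable,
    integral_withDensity_eq_integral_toReal_smul₀ (η.aemeasurable_chartDensity x)
      (Filter.Eventually.of_forall fun _ => ENNReal.ofReal_lt_top)]
  refine integral_congr_ae (Filter.Eventually.of_forall fun y => ?_)
  simp only [ENNReal.toReal_ofReal (η.chartDensity_nonneg x y)]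

/-- Nonempty open sets have positive volume: some chart density is positive at a given point. -/
theorem VolumeForm.measure_pos_of_isOpen (η : VolumeForm n M) {V : Set M} (hV : IsOpen V)
    (hne : V.Nonempty) : 0 < η.measure V := by
  obtain ⟨m, hm⟩ := hne
  obtain ⟨x, hx⟩ : ∃ x, 0 < chartPartition n M x m :=
    (chartPartition n M).exists_pos_of_mem (mem_univ m)
  set e := chartAt (Euc n) x
  have hme : m ∈ e.source :=
    chartPartition_isSubordinate x (subset_tsupport _ hx.ne')
  have hle : η.chartMeasure x V ≤ η.measure V := by
    rw [η.measure_eq_sum]; exact Measure.le_sum _ x V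
  refine lt_of_lt_of_le ?_ hle
  rw [chartMeasure, Measure.map_apply_of_aemeasurable (η.aemeasurable_chart_symm x)
    hV.measurableSet]
  refine pos_iff_ne_zero.2 fun h0 => ?_
  rw [withDensity_apply_eq_zero' (η.aemeasurable_chartDensity x),
    Measure.restrict_apply₀' e.open_target.measurableSet.nullMeasurableSet] at h0
  have hcd : ContinuousAt (η.chartDensity x) (e m) :=
    (η.continuousOn_chartDensity x).continuousAt (e.open_target.mem_nhds (e.map_source hme))
  have hpos : 0 < η.chartDensity x (e m) := by
    refine mul_pos ?_ (abs_pos.2 (η.formCoeff_ne_zero (chart_mem_atlas _ x) (e.map_source hme)))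
    change 0 < chartPartition n M x (e.symm (e m))
    rwa [e.left_inv hme]
  have hsy : ContinuousAt e.symm (e m) := e.continuousAt_symm (e.map_source hme)
  have hVm : V ∈ 𝓝 (e.symm (e m)) := by rw [e.left_inv hme]; exact hV.mem_nhds hm
  refine (Measure.measure_pos_of_mem_nhds volume (x := e m) ?_).ne' h0
  filter_upwards [hcd.eventually (lt_mem_nhds hpos), hsy hVm,
    e.open_target.mem_nhds (e.map_source hme)] with y h1 h2 h3
  exact ⟨⟨by simpa using h1, h2⟩, h3⟩

end Volume

end RiemDiff

namespace RiemDiff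

/-! ### Plots of the mapping space in charts -/

section MappingSpace

variable {n : ℕ} {M : Type*} [TopologicalSpace M] [ChartedSpace (Euc n) M]
  [IsManifold (𝓡 n) ∞ M] [DiffeologicalSpace M] {N : Type*} [DiffeologicalSpace N]

/-- In the chart `e` at `c`, a plot `P` of `C^∞(M, N)` becomes the plot
`(r, y) ↦ P r (e⁻¹ y)` of `N`, on the product of the domain of `P` with the target of `e`. Of the
diffeology of `M` it only matters that smooth parametrizations are plots, which is the
hypothesis `hM`. -/
noncomputable def Plot.inChart (hM : ∀ (m : ℕ) (p : Euc m → M), ContMDiff (𝓡 m) (𝓡 n) ∞ p → IsPlot p)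
    (P : Plot (SmoothMap M N)) (c : M) : Plot N where
  dim := P.dim + n
  dom := (EuclideanSpace.finAddEquivProd (𝕜 := ℝ) (n := P.dim) (m := n)) ⁻¹'
    (P.dom ×ˢ (chartAt (Euc n) c).target)
  isOpen_dom := (P.isOpen_dom.prod (chartAt (Euc n) c).open_target).preimage
    (ContinuousLinearEquiv.continuous _)
  toFun z := P.toFun (EuclideanSpace.finAddEquivProd z).1
    ((chartAt (Euc n) c).symm (EuclideanSpace.finAddEquivProd z).2)
  isPlot_comp m f hf hm := by
    have h1 : ContDiff ℝ ∞ fun t => EuclideanSpace.finAddEquivProd (𝕜 := ℝ) (f t) :=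
      (ContinuousLinearEquiv.contDiff _).comp hf
    have hP := P.isPlot_comp m (fun t => (EuclideanSpace.finAddEquivProd (𝕜 := ℝ) (f t)).1)
      (contDiff_fst.comp h1) fun t => (hm t).1
    refine hP m (fun t => (t, (chartAt (Euc n) c).symm
      (EuclideanSpace.finAddEquivProd (𝕜 := ℝ) (f t)).2)) ⟨isPlot_id', hM _ _ ?_⟩
    have h2 : ContMDiffOn (𝓡 n) (𝓡 n) ∞ (chartAt (Euc n) c).symm (chartAt (Euc n) c).target :=
      contMDiffOn_chart_symm
    exact h2.comp_contMDiff (contDiff_snd.comp h1).contMDiff fun t => (hm t).2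

variable {gN : T₂ N → ℝ}

/-- The tensors `gN(ev_m ∘ P)` depend smoothly on `m`: in a chart, they are restrictions of a
single smooth tensor on the product of the domain of `P` with the target of the chart, because
`r ↦ (r, y)` is a morphism of plots. -/
theorem exists_tensor_inChart
    (hM : ∀ (m : ℕ) (p : Euc m → M), ContMDiff (𝓡 m) (𝓡 n) ∞ p → IsPlot p)
    (hgN : IsWeakRiemannianMetric gN) (P : Plot (SmoothMap M N)) (c : M) :
    ∃ B : Euc P.dim × Euc n → Euc P.dim →L[ℝ] Euc P.dim →L[ℝ] ℝ,
      ContDiffOn ℝ ∞ B (P.dom ×ˢ (chartAt (Euc n) c).target) ∧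
      ∀ (r : P.dom), ∀ y ∈ (chartAt (Euc n) c).target, ∀ v w : Euc P.dim,
        gN (T₂.mk (P.map (dSmooth_ev ((chartAt (Euc n) c).symm y))) r v w) = B (r, y) v w := by
  set φ := EuclideanSpace.finAddEquivProd (𝕜 := ℝ) (n := P.dim) (m := n)
  obtain ⟨B₀, hB₀, hB₀e⟩ := hgN.tensor (P.inChart hM c)
  let ι : Euc P.dim →L[ℝ] Euc (P.dim + n) :=
    (φ.symm : (Euc P.dim × Euc n) →L[ℝ] Euc (P.dim + n)).comp
      (ContinuousLinearMap.inl ℝ (Euc P.dim) (Euc n))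
  let pre : (Euc (P.dim + n) →L[ℝ] ℝ) →L[ℝ] (Euc P.dim →L[ℝ] ℝ) :=
    (ContinuousLinearMap.compL ℝ (Euc P.dim) (Euc (P.dim + n)) ℝ).flip ι
  let B₁ : Euc (P.dim + n) → Euc (P.dim + n) →L[ℝ] Euc (P.dim + n) →L[ℝ] ℝ := B₀
  have hB₁ : ContDiffOn ℝ ∞ B₁ (φ ⁻¹' (P.dom ×ˢ (chartAt (Euc n) c).target)) := hB₀
  refine ⟨fun z => pre.comp ((B₁ (φ.symm z)).comp ι), ?_, fun r y hy v w => ?_⟩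
  · refine contDiffOn_const.clm_comp (ContDiffOn.clm_comp ?_ contDiffOn_const)
    exact hB₁.comp φ.symm.contDiff.contDiffOn fun z hz => by simpa using hz
  · let h : Euc P.dim → Euc (P.dim + n) := fun r => φ.symm (r, y)
    have hd (r : Euc P.dim) : HasFDerivAt h ι r :=
      (φ.symm : (Euc P.dim × Euc n) →L[ℝ] Euc (P.dim + n)).hasFDerivAt.comp r
        (hasFDerivAt_prodMk_left r y)
    have hφ (r : Euc P.dim) : φ (h r) = (r, y) := φ.apply_symm_apply _
    have hdom : ∀ r ∈ P.dom, φ (h r) ∈ P.dom ×ˢ (chartAt (Euc n) c).target := fun r hr => by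
      rw [hφ]; exact ⟨hr, hy⟩
    have hcomp (r : Euc P.dim) : P.toFun (φ (h r)).1 ((chartAt (Euc n) c).symm (φ (h r)).2) =
        P.toFun r ((chartAt (Euc n) c).symm y) := by rw [hφ]
    have key := T₂.mk_eq_of_local (P.map (dSmooth_ev ((chartAt (Euc n) c).symm y)))
      (P.inChart hM c) P.isOpen_dom (h := h)
      (φ.symm.contDiff.comp (contDiff_id.prodMk contDiff_const)).contDiffOn
      hdom (fun r _ => hcomp r) r r.2 v w
    refine (congrArg gN (key.trans (T₂.mk_congr _ rfl
      (congrArg (· v) (hd r).fderiv) (congrArg (· w) (hd r).fderiv)))).trans ?_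
    exact hB₀e ⟨h r, _⟩ (ι v) (ι w)

/-- For a plot `P` of `C^∞(M, N)`, the number `gN(ev_m ∘ P)_r(v, w)` is jointly continuous in `r`
and `m`. -/
theorem continuous_tensor_ev
    (hM : ∀ (m : ℕ) (p : Euc m → M), ContMDiff (𝓡 m) (𝓡 n) ∞ p → IsPlot p)
    (hgN : IsWeakRiemannianMetric gN) (P : Plot (SmoothMap M N)) (v w : Euc P.dim) :
    Continuous fun q : P.dom × M => gN (T₂.mk (P.map (dSmooth_ev q.2)) q.1 v w) := by
  refine continuous_iff_continuousAt.2 fun ⟨r, c⟩ => ?_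
  obtain ⟨B, hB, hBe⟩ := exists_tensor_inChart hM hgN P c
  set e := chartAt (Euc n) c
  have hc : c ∈ e.source := mem_chart_source _ _
  have hBc : ContinuousAt B ((r : Euc P.dim), e c) :=
    hB.continuousOn.continuousAt ((P.isOpen_dom.prod e.open_target).mem_nhds
      ⟨r.2, e.map_source hc⟩)
  have h1 : ContinuousAt (fun q : P.dom × M => ((q.1 : Euc P.dim), e q.2)) (r, c) :=
    (continuous_subtype_val.comp continuous_fst).continuousAt.prodMk
      ((e.continuousAt hc).comp (f := Prod.snd) (x := (r, c)) continuousAt_snd)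
  have h2 : ContinuousAt (fun q : P.dom × M => B ((q.1 : Euc P.dim), e q.2)) (r, c) :=
    ContinuousAt.comp (g := B) (f := fun q : P.dom × M => ((q.1 : Euc P.dim), e q.2)) hBc h1
  have h3 : ContinuousAt (fun q : P.dom × M => B ((q.1 : Euc P.dim), e q.2) v w) (r, c) :=
    (h2.clm_apply continuousAt_const).clm_apply continuousAt_const
  refine h3.congr ?_
  filter_upwards [continuousAt_snd.preimage_mem_nhds (e.open_source.mem_nhds hc)] with q hq
  have := hBe q.1 (e q.2) (e.map_source hq) v w
  rw [← this]
  have hq' : e.symm (e q.2) = q.2 := e.left_inv hq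
  rw [hq']

theorem continuous_tensor_ev_right
    (hM : ∀ (m : ℕ) (p : Euc m → M), ContMDiff (𝓡 m) (𝓡 n) ∞ p → IsPlot p)
    (hgN : IsWeakRiemannianMetric gN) (P : Plot (SmoothMap M N)) (r : P.dom) (v w : Euc P.dim) :
    Continuous fun m : M => gN (T₂.mk (P.map (dSmooth_ev m)) r v w) :=
  (continuous_tensor_ev hM hgN P v w).comp (continuous_const.prodMk continuous_id)

/-- Smooth maps from a manifold are continuous for the pseudodistance. -/
theorem eventually_pseudoDist_map_le
    (hM : ∀ (m : ℕ) (p : Euc m → M), ContMDiff (𝓡 m) (𝓡 n) ∞ p → IsPlot p)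
    (hgN : IsWeakRiemannianMetric gN) (f : SmoothMap M N) (c : M) {ε : ℝ} (hε : 0 < ε) :
    ∀ᶠ m in 𝓝 c, pseudoDist gN (f c) (f m) ≤ ENNReal.ofReal ε := by
  set e := chartAt (Euc n) c
  have hc : c ∈ e.source := mem_chart_source _ _
  let Q : Plot N :=
    { dim := n
      dom := e.target
      isOpen_dom := e.open_target
      toFun := fun y => f (e.symm y)
      isPlot_comp := fun m k hk hm => f.2 m (fun t => e.symm (k t)) (hM _ _
        ((contMDiffOn_chart_symm (I := 𝓡 n) (n := ∞)).comp_contMDiff hk.contMDiff hm)) }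
  have h := eventually_pseudoDist_plot_le hgN Q (x := e c) (e.map_source hc) hε
  filter_upwards [(e.continuousAt hc).eventually h, e.open_source.mem_nhds hc] with m hm hms
  have h1 : Q.toFun (e c) = f c := congrArg f (e.left_inv hc)
  have h2 : Q.toFun (e m) = f m := congrArg f (e.left_inv hms)
  rwa [h1, h2] at hm

/-- If `f c ≠ h c`, then `f m` and `h m` stay at a distance bounded below for `m` near `c`. -/
theorem exists_eventually_le_pseudoDist
    (hM : ∀ (m : ℕ) (p : Euc m → M), ContMDiff (𝓡 m) (𝓡 n) ∞ p → IsPlot p)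
    (hgN : IsWeakRiemannianMetric gN) (f h : SmoothMap M N) {c : M}
    (hne : pseudoDist gN (f c) (h c) ≠ 0) :
    ∃ ε : ℝ, 0 < ε ∧ ∀ᶠ m in 𝓝 c, ENNReal.ofReal ε ≤ pseudoDist gN (f m) (h m) := by
  obtain ⟨r, hr0, hr, hrlt⟩ := ENNReal.lt_iff_exists_real_btwn.1 (pos_iff_ne_zero.2 hne)
  have hr' : 0 < r := ENNReal.ofReal_pos.1 hr
  have hε : 0 < r / 3 := by positivity
  refine ⟨r / 3, hε, ?_⟩
  filter_upwards [eventually_pseudoDist_map_le hM hgN f c hε,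
    eventually_pseudoDist_map_le hM hgN h c hε] with m hf hh
  by_contra! hlt
  have h1 := pseudoDist_triangle hgN (f c) (f m) (h c)
  have h2 := pseudoDist_triangle hgN (f m) (h m) (h c)
  rw [pseudoDist_comm hgN (h m)] at h2
  refine hrlt.not_ge (h1.trans ((add_le_add hf (h2.trans (add_le_add hlt.le hh))).trans_eq ?_))
  rw [← ENNReal.ofReal_add hε.le hε.le, ← ENNReal.ofReal_add hε.le (by positivity)]
  congr 1
  ring

/-- The path `t ↦ γ t m` in `N` of a path `γ` in `C^∞(M, N)`. -/
def evPath (γ : SmoothMap ℝ (SmoothMap M N)) (m : M) : SmoothMap ℝ N :=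
  ⟨fun t => γ t m, (dSmooth_ev m).comp γ.2⟩

theorem continuous_speedSq_evPath
    (hM : ∀ (m : ℕ) (p : Euc m → M), ContMDiff (𝓡 m) (𝓡 n) ∞ p → IsPlot p)
    (hgN : IsWeakRiemannianMetric gN) (γ : SmoothMap ℝ (SmoothMap M N)) :
    Continuous fun q : ℝ × M => speedSq gN (evPath γ q.2) q.1 := by
  have h1 : Continuous fun t : ℝ => (EuclideanSpace.single (0 : Fin 1) t : Euc 1) := by
    rw [euc_single_eq_smul]; fun_prop
  have h2 : Continuous fun t : ℝ =>
      (⟨EuclideanSpace.single (0 : Fin 1) t, mem_univ _⟩ : (pathPlot γ).dom) :=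
    Continuous.subtype_mk h1 _
  exact (continuous_tensor_ev hM hgN (pathPlot γ) (EuclideanSpace.single (0 : Fin 1) 1)
    (EuclideanSpace.single (0 : Fin 1) 1)).comp
      (f := fun q : ℝ × M => (⟨EuclideanSpace.single (0 : Fin 1) q.1, mem_univ _⟩, q.2))
      ((h2.comp continuous_fst).prodMk continuous_snd)

/-! ### The induced metric on the mapping space -/

variable [CompactSpace M] [T2Space M] [MeasurableSpace M] [BorelSpace M]

/-- The induced metric is a smooth tensor: it is a finite sum of integrals over chart targets,
and differentiation under these integrals is possible as the tensors are jointly smooth in the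
parameter and the point of the chart. -/
theorem isCovariantTwoTensor_mappingMetric
    (hM : ∀ (m : ℕ) (p : Euc m → M), ContMDiff (𝓡 m) (𝓡 n) ∞ p → IsPlot p)
    (hgN : IsWeakRiemannianMetric gN) (η : VolumeForm n M) (P : Plot (SmoothMap M N)) :
    IsCovariantTwoTensor P.dom fun r v w => mappingMetric η.measure gN (T₂.mk P r v w) := by
  choose B hB hBe using exists_tensor_inChart hM hgN P
  refine ⟨fun r => ∑ x ∈ (finite_chartPartition_ne_zero (n := n) (M := M)).toFinset,
    ∫ y in (chartAt (Euc n) x).target, η.chartDensity x y • B x (r, y), ?_, fun r v w => ?_⟩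
  · refine ContDiffOn.sum fun x _ => ?_
    exact contDiffOn_setIntegral_smul volume P.isOpen_dom (chartAt (Euc n) x).open_target
      (isCompact_chartSupport x) (chartSupport_subset_target x)
      (contDiffOn_chartPartition_symm x) (fun y hy hyK => chartPartition_symm_eq_zero hy hyK)
      (η.continuousOn_abs_formCoeff x) (hB x)
  · refine (η.integral_eq_sum (continuous_tensor_ev_right hM hgN P r v w)).trans ?_
    rw [sum_apply, sum_apply]
    refine Finset.sum_congr rfl fun x _ => ?_
    have hc : ContinuousOn (fun y => B x (r, y)) (chartAt (Euc n) x).target :=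
      (hB x).continuousOn.comp (by fun_prop) fun y hy => ⟨r.2, hy⟩
    have hi := η.integrableOn_chartDensity_smul x (E := Euc P.dim →L[ℝ] Euc P.dim →L[ℝ] ℝ) hc
    rw [ContinuousLinearMap.integral_apply hi, ContinuousLinearMap.integral_apply
      (Integrable.apply_continuousLinearMap hi v)]
    refine setIntegral_congr_fun (chartAt (Euc n) x).open_target.measurableSet fun y hy => ?_
    exact congrArg (η.chartDensity x y • ·) (hBe x r y hy v w)

theorem isWeakRiemannianMetric_mappingMetric
    (hM : ∀ (m : ℕ) (p : Euc m → M), ContMDiff (𝓡 m) (𝓡 n) ∞ p → IsPlot p)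
    (hgN : IsWeakRiemannianMetric gN) (η : VolumeForm n M) :
    IsWeakRiemannianMetric (mappingMetric (X := M) (Y := N) η.measure gN) where
  tensor := isCovariantTwoTensor_mappingMetric hM hgN η
  symm P r v w := integral_congr_ae (Filter.Eventually.of_forall fun m =>
    hgN.symm (P.map (dSmooth_ev m)) r v w)
  nonneg P r v := integral_nonneg fun m => hgN.nonneg (P.map (dSmooth_ev m)) r v

/-! ### Comparison of the pseudodistances -/

/-- The mean over `M` of the lengths of the paths `t ↦ γ t m` is controlled by the length of `γ`:
after exchanging the integrals, this is the Cauchy-Schwarz inequality on `M` at each time. -/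
theorem lintegral_pathLength_evPath_le
    (hM : ∀ (m : ℕ) (p : Euc m → M), ContMDiff (𝓡 m) (𝓡 n) ∞ p → IsPlot p)
    (hgN : IsWeakRiemannianMetric gN) (η : VolumeForm n M) (γ : SmoothMap ℝ (SmoothMap M N)) :
    ∫⁻ m, pathLength gN (evPath γ m) ∂η.measure ≤
      η.measure univ ^ (1 / 2 : ℝ) * pathLength (mappingMetric η.measure gN) γ := by
  have : SecondCountableTopology M := ChartedSpace.secondCountable_of_sigmaCompact (Euc n) M
  have hcont := continuous_speedSq_evPath hM hgN γ
  have hmeas : Measurable fun q : M × ℝ =>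
      ENNReal.ofReal √(speedSq gN (evPath γ q.1) q.2) :=
    (hcont.comp continuous_swap).sqrt.measurable.ennreal_ofReal
  unfold pathLength
  rw [lintegral_lintegral_swap hmeas.aemeasurable,
    ← lintegral_const_mul' _ _ (ENNReal.rpow_ne_top_of_nonneg (by norm_num)
      (measure_ne_top η.measure univ))]
  refine lintegral_mono fun t => ?_
  have hct : Continuous fun m : M => speedSq gN (evPath γ m) t :=
    hcont.comp (continuous_const.prodMk continuous_id)
  have hCS := ENNReal.lintegral_mul_le_Lp_mul_Lq η.measure
    (Real.HolderConjugate.two_two) (f := fun _ => 1)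
    (g := fun m => ENNReal.ofReal √(speedSq gN (evPath γ m) t)) aemeasurable_const
    hct.sqrt.measurable.ennreal_ofReal.aemeasurable
  simp only [Pi.mul_def, one_mul, ENNReal.one_rpow, lintegral_one] at hCS
  refine hCS.trans_eq ?_
  congr 1
  have hsq (m : M) : ENNReal.ofReal √(speedSq gN (evPath γ m) t) ^ (2 : ℝ) =
      ENNReal.ofReal (speedSq gN (evPath γ m) t) := by
    rw [ENNReal.ofReal_rpow_of_nonneg (Real.sqrt_nonneg _) (by norm_num), Real.rpow_two,
      Real.sq_sqrt (speedSq_nonneg hgN _ _)]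
  simp only [hsq]
  rw [← ofReal_integral_eq_lintegral_ofReal (η.integrable_of_continuous hct)
    (Filter.Eventually.of_forall fun m => speedSq_nonneg hgN _ _),
    ENNReal.ofReal_rpow_of_nonneg (integral_nonneg fun m => speedSq_nonneg hgN _ _)
      (by norm_num), ← Real.sqrt_eq_rpow]
  rfl

/-- If `f c ≠ h c`, then the pointwise distance of `f` and `h` is at least some `ε > 0` on an open
set `V`, so that every path from `f` to `h` has length at least `ε vol(V) / vol(M)^{1/2}`. -/
theorem eq_of_pseudoDist_mappingMetric_eq_zero
    (hM : ∀ (m : ℕ) (p : Euc m → M), ContMDiff (𝓡 m) (𝓡 n) ∞ p → IsPlot p)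
    (hgN : IsWeakRiemannianMetric gN) (η : VolumeForm n M)
    (hN : ∀ x y, pseudoDist gN x y = 0 → x = y) {f h : SmoothMap M N}
    (h0 : pseudoDist (mappingMetric η.measure gN) f h = 0) : f = h := by
  refine Subtype.ext (funext fun c => hN _ _ ?_)
  by_contra hne
  obtain ⟨ε, hε, hev⟩ := exists_eventually_le_pseudoDist hM hgN f h hne
  obtain ⟨V, hVε, hV, hcV⟩ := eventually_nhds_iff.1 hev
  set C := η.measure univ ^ (1 / 2 : ℝ)
  have hC : C ≠ ⊤ := ENNReal.rpow_ne_top_of_nonneg (by norm_num) (measure_ne_top _ _)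
  have hbound (γ : SmoothMap ℝ (SmoothMap M N)) (hγ0 : γ 0 = f) (hγ1 : γ 1 = h) :
      ENNReal.ofReal ε * η.measure V / C ≤ pathLength (mappingMetric η.measure gN) γ := by
    refine ENNReal.div_le_of_le_mul' (le_trans ?_ (lintegral_pathLength_evPath_le hM hgN η γ))
    rw [← setLIntegral_const]
    refine (setLIntegral_mono' hV.measurableSet fun m hm => ?_).trans (setLIntegral_le_lintegral V _)
    refine (hVε m hm).trans ?_
    have := pseudoDist_le_pathLength gN (evPath γ m)
    simpa [evPath, hγ0, hγ1] using this
  have hle : ENNReal.ofReal ε * η.measure V / C ≤ 0 :=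
    h0 ▸ le_iInf fun γ => le_iInf fun hγ0 => le_iInf fun hγ1 => hbound γ hγ0 hγ1
  -- A quotient in `[0, ∞]` also vanishes for an infinite denominator, but the volume is finite.
  rcases ENNReal.div_eq_zero_iff.1 (le_zero_iff.1 hle) with h1 | h1
  · rcases mul_eq_zero.1 h1 with h2 | h2
    · exact (ENNReal.ofReal_pos.2 hε).ne' h2
    · exact (η.measure_pos_of_isOpen hV ⟨c, hcV⟩).ne' h2
  · exact hC h1

end MappingSpace

end RiemDiff

theorem proposition5p2 {n : ℕ} {M : Type*} [TopologicalSpace M] [ChartedSpace (Euc n) M]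
    [IsManifold (𝓡 n) ∞ M] [CompactSpace M] [T2Space M] [MeasurableSpace M] [BorelSpace M]
    (η : VolumeForm n M) {N : Type*} [DiffeologicalSpace N] (gN : T₂ N → ℝ)
    (hgN : IsWeakRiemannianMetric gN) :
    letI : DiffeologicalSpace M := manifoldDiffeology n M
    letI g : T₂ (SmoothMap M N) → ℝ := mappingMetric η.measure gN
    (∀ ξ : T₂ (SmoothMap M N),
      Integrable (fun m : M => gN (T₂.map (dSmooth_ev m) ξ)) η.measure) ∧
    IsWeakRiemannianMetric g ∧
    (IsDistance (pseudoDist gN) → IsDistance (pseudoDist g)) := by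
  let : DiffeologicalSpace M := manifoldDiffeology n M
  -- The plots of the manifold diffeology are by definition its smooth maps.
  have hM : ∀ (m : ℕ) (p : Euc m → M), ContMDiff (𝓡 m) (𝓡 n) ∞ p → IsPlot p := fun _ _ hp => hp
  have hg := isWeakRiemannianMetric_mappingMetric hM hgN η
  refine ⟨fun ξ => ?_, hg, fun hd => ⟨pseudoDist_self hg, pseudoDist_comm hg,
    pseudoDist_triangle hg, fun f h => eq_of_pseudoDist_mappingMetric_eq_zero hM hgN η
      hd.eq_of_zero⟩⟩
  obtain ⟨P, r, v, w⟩ := ξ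
  exact η.integrable_of_continuous (continuous_tensor_ev_right hM hgN P r v w)
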